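/- Let $k\ge 0$ be an integer and let $$h_k(t)=(t,\ \cos t,\ \sin t,\ \cos 2t,\ \sin 2t,\ \dots,\ \cos kt,\ \sin kt)\in\mathbb{R}^{2k+1}$$ be the generalized helix. Let $P$ be any finite set of points on $h_k$ with parameters in the range $0<t<2\pi$. Then the Voronoi diagram of $P$, that is, the family of the closed Voronoi regions $$V(p)=\{x\in\mathbb{R}^{2k+1} : \|x-p\|\le\|x-q\|\text{ for all } q\in P\},\qquad p\in P,$$ is a $(k+1)$-neighborly family of convex polyhedra in $\mathbb{R}^{2k+1}$. Here a convex polyhedron is an intersection of finitely many closed half-spaces (it may be unbounded), and a family of $d$-dimensional convex polyhedra in $\mathbb{R}^d$ is called $m$-neighborly if the intersection of any $m$ of its members is a nonempty set of dimension $d-m+1$, while no $m+1$ of its members have an intersection of dimension $d-m+1$. Thus, for $d=2k+1$ and $m=k+1$: each $V(p)$ is a convex polyhedron of dimension $2k+1$, any $k+1$ of the regions have an intersection of dimension exactly $k+1$, and the intersection of any $k+2$ of the regions is empty or has dimension at most $k$. -/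

import Mathlib

/-- The generalized helix `t ↦ (t, cos t, sin t, cos 2t, sin 2t, …, cos kt, sin kt)` in
`ℝ^(2k+1)`: coordinate `0` is `t`, coordinate `2j-1` is `cos (j t)` and coordinate `2j` is
`sin (j t)` for `1 ≤ j ≤ k`. -/
noncomputable def genHelix (k : ℕ) (t : ℝ) : EuclideanSpace ℝ (Fin (2 * k + 1)) :=
  WithLp.toLp 2 fun i =>
    if i.val = 0 then t
    else if i.val % 2 = 1 then Real.cos ((((i.val + 1) / 2 : ℕ) : ℝ) * t)
    else Real.sin (((i.val / 2 : ℕ) : ℝ) * t)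

/-- The closed Voronoi region of the site `p` with respect to the set of sites `P`. -/
def voronoiRegion {d : ℕ} (P : Set (EuclideanSpace ℝ (Fin d))) (p : EuclideanSpace ℝ (Fin d)) :
    Set (EuclideanSpace ℝ (Fin d)) :=
  {x | ∀ q ∈ P, dist x p ≤ dist x q}

/-- The Voronoi diagram of `P`: the family of the Voronoi regions of the sites, indexed by `P`. -/
def voronoiDiagram {d : ℕ} (P : Set (EuclideanSpace ℝ (Fin d))) :
    P → Set (EuclideanSpace ℝ (Fin d)) :=
  fun p => voronoiRegion P p

/-- A convex polyhedron (possibly unbounded): the intersection of finitely many closed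
half-spaces, i.e. the solution set of a finite system of linear inequalities. -/
def IsConvexPolyhedron {d : ℕ} (S : Set (EuclideanSpace ℝ (Fin d))) : Prop :=
  ∃ H : Finset (EuclideanSpace ℝ (Fin d) × ℝ), S = {x | ∀ h ∈ H, inner ℝ h.1 x ≤ h.2}

/-- `S` is a nonempty set whose affine hull has dimension `n`. -/
def HasAffineDim {d : ℕ} (S : Set (EuclideanSpace ℝ (Fin d))) (n : ℤ) : Prop :=
  S.Nonempty ∧ (Module.finrank ℝ (vectorSpan ℝ S) : ℤ) = n

/-- A family of `d`-dimensional convex polyhedra in `ℝ^d` is `m`-neighborly if the intersection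
of any `m` of its members has dimension `d - m + 1`, and no `m + 1` of its members have an
intersection of that dimension. -/
structure IsNeighborlyFamily {d : ℕ} {ι : Type*} (m : ℕ)
    (F : ι → Set (EuclideanSpace ℝ (Fin d))) : Prop where
  polyhedron : ∀ i, IsConvexPolyhedron (F i)
  full_dim : ∀ i, HasAffineDim (F i) d
  inter_dim : ∀ s : Finset ι, s.card = m → HasAffineDim (⋂ i ∈ s, F i) ((d : ℤ) - m + 1)
  inter_succ : ∀ s : Finset ι, s.card = m + 1 → ¬ HasAffineDim (⋂ i ∈ s, F i) ((d : ℤ) - m + 1)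

/-- A real trigonometric polynomial of degree at most `k` without constant term. -/
noncomputable def trigSum (k : ℕ) (a b : ℕ → ℝ) (t : ℝ) : ℝ :=
  ∑ j ∈ Finset.range k, (a j * Real.cos ((j + 1 : ℝ) * t) + b j * Real.sin ((j + 1 : ℝ) * t))

theorem hasDerivAt_trigSum (k : ℕ) (a b : ℕ → ℝ) (t : ℝ) :
    HasDerivAt (trigSum k a b)
      (trigSum k (fun j => (j + 1 : ℝ) * b j) (fun j => -((j + 1 : ℝ) * a j)) t) t := by
  unfold trigSum
  apply HasDerivAt.fun_sum
  intro j _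
  have hl : HasDerivAt (fun t : ℝ => (j + 1 : ℝ) * t) (j + 1 : ℝ) t := by
    simpa using (hasDerivAt_id t).const_mul (j + 1 : ℝ)
  refine ((hl.cos.const_mul (a j)).add (hl.sin.const_mul (b j))).congr_deriv ?_
  ring

theorem trigSum_add_two_pi (k : ℕ) (a b : ℕ → ℝ) (t : ℝ) :
    trigSum k a b (t + 2 * Real.pi) = trigSum k a b t := by
  unfold trigSum
  refine Finset.sum_congr rfl fun j _ => ?_
  have h : (j + 1 : ℝ) * (t + 2 * Real.pi) = (j + 1 : ℝ) * t + ((j + 1 : ℕ) : ℝ) * (2 * Real.pi) := by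
    push_cast; ring
  rw [h, Real.cos_add_nat_mul_two_pi, Real.sin_add_nat_mul_two_pi]

/-- The complex polynomial `Q` of degree at most `2k` with
`Q (exp (i t)) = exp (i k t) (c + trigSum k a b t)`. -/
noncomputable def trigPolynomial (k : ℕ) (c : ℝ) (a b : ℕ → ℝ) : Polynomial ℂ :=
  Polynomial.C (c : ℂ) * Polynomial.X ^ k + ∑ j ∈ Finset.range k,
    (Polynomial.C (((a j : ℂ) - b j * Complex.I) / 2) * Polynomial.X ^ (k + (j + 1)) +
      Polynomial.C (((a j : ℂ) + b j * Complex.I) / 2) * Polynomial.X ^ (k - (j + 1)))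

theorem eval_trigPolynomial (k : ℕ) (c : ℝ) (a b : ℕ → ℝ) (t : ℝ) :
    (trigPolynomial k c a b).eval (Complex.exp (t * Complex.I)) =
      Complex.exp (t * Complex.I) ^ k * ((c + trigSum k a b t : ℝ) : ℂ) := by
  have hne : Complex.exp (t * Complex.I) ≠ 0 := Complex.exp_ne_zero _
  unfold trigPolynomial trigSum
  rw [Polynomial.eval_add, Polynomial.eval_finsetSum]
  push_cast
  rw [mul_add, Finset.mul_sum]
  congr 1
  · rw [Polynomial.eval_mul, Polynomial.eval_C, Polynomial.eval_pow, Polynomial.eval_X, mul_comm]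
  refine Finset.sum_congr rfl fun j hj => ?_
  have hj : j + 1 ≤ k := Finset.mem_range.1 hj
  have e : ((j + 1 : ℂ) * t) * Complex.I = ((j + 1 : ℕ) : ℂ) * (t * Complex.I) := by push_cast; ring
  have h1 : Complex.exp ((j + 1 : ℂ) * t * Complex.I) = Complex.exp (t * Complex.I) ^ (j + 1) := by
    rw [e, Complex.exp_nat_mul]
  have h2 : Complex.exp (-((j + 1 : ℂ) * t) * Complex.I)
      = (Complex.exp (t * Complex.I) ^ (j + 1))⁻¹ := by
    rw [neg_mul, Complex.exp_neg, h1]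
  rw [Complex.cos, Complex.sin, h1, h2]
  simp only [Polynomial.eval_add, Polynomial.eval_mul, Polynomial.eval_C, Polynomial.eval_pow,
    Polynomial.eval_X]
  rw [pow_add, pow_sub₀ _ hne hj]
  ring

theorem natDegree_trigPolynomial_le (k : ℕ) (c : ℝ) (a b : ℕ → ℝ) :
    (trigPolynomial k c a b).natDegree ≤ 2 * k := by
  refine Polynomial.natDegree_add_le_of_degree_le
    ((Polynomial.natDegree_C_mul_X_pow_le _ _).trans (by omega)) ?_
  refine Polynomial.natDegree_sum_le_of_forall_le _ _ fun j hj => ?_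
  have hj : j + 1 ≤ k := Finset.mem_range.1 hj
  exact Polynomial.natDegree_add_le_of_degree_le
    ((Polynomial.natDegree_C_mul_X_pow_le _ _).trans (by omega))
    ((Polynomial.natDegree_C_mul_X_pow_le _ _).trans (by omega))

theorem coeff_trigPolynomial_self (k : ℕ) (c : ℝ) (a b : ℕ → ℝ) :
    (trigPolynomial k c a b).coeff k = c := by
  unfold trigPolynomial
  rw [Polynomial.coeff_add, Polynomial.finsetSum_coeff, Finset.sum_eq_zero]
  · simp
  intro j hj
  have hj : j + 1 ≤ k := Finset.mem_range.1 hj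
  rw [Polynomial.coeff_add, Polynomial.coeff_C_mul_X_pow, Polynomial.coeff_C_mul_X_pow,
    if_neg (by omega), if_neg (by omega), add_zero]

theorem coeff_trigPolynomial_add (k : ℕ) (c : ℝ) (a b : ℕ → ℝ) {i : ℕ} (hi : i < k) :
    (trigPolynomial k c a b).coeff (k + (i + 1)) = ((a i : ℂ) - b i * Complex.I) / 2 := by
  unfold trigPolynomial
  rw [Polynomial.coeff_add, Polynomial.finsetSum_coeff, Finset.sum_eq_single i]
  · rw [Polynomial.coeff_add, Polynomial.coeff_C_mul_X_pow, Polynomial.coeff_C_mul_X_pow,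
      Polynomial.coeff_C_mul_X_pow, if_neg (by omega), if_pos rfl, if_neg (by omega)]
    ring
  · intro j _ hji
    rw [Polynomial.coeff_add, Polynomial.coeff_C_mul_X_pow, Polynomial.coeff_C_mul_X_pow,
      if_neg (by omega), if_neg (by omega), add_zero]
  · intro h
    exact absurd (Finset.mem_range.2 hi) h

theorem exp_mul_I_injOn_Ioo :
    Set.InjOn (fun t : ℝ => Complex.exp (t * Complex.I)) (Set.Ioo 0 (2 * Real.pi)) := by
  intro s hs t ht hst
  obtain ⟨n, hn⟩ := Complex.exp_eq_exp_iff_exists_int.1 hst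
  have hn' : s = t + n * (2 * Real.pi) := by
    have h2 : ((s : ℂ)) = ((t + n * (2 * Real.pi) : ℝ) : ℂ) := by
      apply mul_right_cancel₀ Complex.I_ne_zero
      rw [hn]; push_cast; ring
    exact_mod_cast h2
  have hpi := Real.two_pi_pos
  have h1 : (n : ℝ) < 1 := by
    by_contra! h
    nlinarith [hs.2, ht.1]
  have h2 : (-1 : ℝ) < n := by
    by_contra! h
    nlinarith [hs.1, ht.2]
  have h3 : n = 0 := by
    have : n < 1 := by exact_mod_cast h1
    have : -1 < n := by exact_mod_cast h2
    omega
  simpa [h3] using hn'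

/-- A trigonometric polynomial of degree at most `k` with more than `2k` zeros in `(0, 2π)`
has only zero coefficients. -/
theorem trigSum_coeff_eq_zero {k : ℕ} {c : ℝ} {a b : ℕ → ℝ} {Z : Finset ℝ}
    (hZ : ↑Z ⊆ Set.Ioo 0 (2 * Real.pi)) (hcard : 2 * k < Z.card)
    (h0 : ∀ t ∈ Z, c + trigSum k a b t = 0) :
    c = 0 ∧ ∀ j < k, a j = 0 ∧ b j = 0 := by
  have hQ : trigPolynomial k c a b = 0 := by
    refine Polynomial.eq_zero_of_natDegree_lt_card_of_eval_eq_zero' _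
      (Z.image fun t : ℝ => Complex.exp (t * Complex.I)) ?_ ?_
    · intro z hz
      obtain ⟨t, ht, rfl⟩ := Finset.mem_image.1 hz
      rw [eval_trigPolynomial, h0 t ht]
      simp
    · rw [Finset.card_image_of_injOn (exp_mul_I_injOn_Ioo.mono hZ)]
      exact (natDegree_trigPolynomial_le k c a b).trans_lt hcard
  constructor
  · have := coeff_trigPolynomial_self k c a b
    rw [hQ, Polynomial.coeff_zero] at this
    exact_mod_cast this.symm
  · intro j hj
    have := coeff_trigPolynomial_add k c a b hj
    rw [hQ, Polynomial.coeff_zero] at this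
    have hre := congrArg Complex.re this
    have him := congrArg Complex.im this
    simp at hre him
    exact ⟨by linarith, by linarith⟩

/-- Rolle's theorem, counting zeros: between the zeros in `A` lie at least `|A| - 1` zeros of the
derivative, none of them in `A`. -/
theorem exists_finset_zeros_deriv {f f' : ℝ → ℝ} (hf : ∀ t, HasDerivAt f (f' t) t)
    {l u : ℝ} {A : Finset ℝ} (hA : ↑A ⊆ Set.Icc l u) (h0 : ∀ t ∈ A, f t = 0) :
    ∃ B : Finset ℝ, ↑B ⊆ Set.Ioo l u ∧ Disjoint A B ∧ A.card ≤ B.card + 1 ∧ ∀ t ∈ B, f' t = 0 := by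
  have key : ∀ x y : ℝ, ∃ z, x ∈ A → y ∈ A → x < y → z ∈ Set.Ioo x y ∧ f' z = 0 := by
    intro x y
    by_cases h : x ∈ A ∧ y ∈ A ∧ x < y
    · obtain ⟨hx, hy, hxy⟩ := h
      obtain ⟨z, hz, hz0⟩ := exists_hasDerivAt_eq_zero hxy
        (fun t _ => (hf t).continuousAt.continuousWithinAt) (by rw [h0 x hx, h0 y hy])
        (fun t _ => hf t)
      exact ⟨z, fun _ _ _ => ⟨hz, hz0⟩⟩
    · exact ⟨0, fun hx hy hxy => absurd ⟨hx, hy, hxy⟩ h⟩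
  choose z hz using key
  let T : Finset ℝ := ((A ×ˢ A).filter fun p => p.1 < p.2).image fun p => z p.1 p.2
  have hT : ∀ w ∈ T, w ∈ Set.Ioo l u ∧ f' w = 0 := by
    intro w hw
    obtain ⟨⟨x, y⟩, hp, rfl⟩ := Finset.mem_image.1 hw
    simp only [Finset.mem_filter, Finset.mem_product] at hp
    obtain ⟨h1, h2⟩ := hz x y hp.1.1 hp.1.2 hp.2
    exact ⟨⟨(hA hp.1.1).1.trans_lt h1.1, h1.2.trans_le (hA hp.1.2).2⟩, h2⟩
  refine ⟨T \ A, ?_, Finset.disjoint_sdiff, ?_, ?_⟩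
  · intro w hw
    exact (hT w (Finset.mem_sdiff.1 hw).1).1
  · refine Finset.card_le_sdiff_of_interleaved fun x hx y hy hxy _ => ⟨z x y, ?_, ?_⟩
    · refine Finset.mem_image.2 ⟨(x, y), ?_, rfl⟩
      simp [hx, hy, hxy]
    · exact (hz x y hx hy hxy).1
  · intro w hw
    exact (hT w (Finset.mem_sdiff.1 hw).1).2

/-- A function `α + β t + T(t)`, with `T` a trigonometric polynomial of degree at most `k`, that
has `2k + 2` zeros in `(0, 2π)`, where the points of `B` count twice, is zero. -/
theorem affine_add_trigSum_coeff_eq_zero {k : ℕ} {α β : ℝ} {a b : ℕ → ℝ} {A B : Finset ℝ}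
    (hA : ↑A ⊆ Set.Ioo 0 (2 * Real.pi)) (hBA : B ⊆ A) (hcard : 2 * k + 2 ≤ A.card + B.card)
    (h0 : ∀ t ∈ A, α + β * t + trigSum k a b t = 0)
    (h1 : ∀ t ∈ B, β + trigSum k (fun j => (j + 1 : ℝ) * b j) (fun j => -((j + 1 : ℝ) * a j)) t = 0) :
    α = 0 ∧ β = 0 ∧ ∀ j < k, a j = 0 ∧ b j = 0 := by
  have hd : ∀ t, HasDerivAt (fun t => α + β * t + trigSum k a b t)
      (β + trigSum k (fun j => (j + 1 : ℝ) * b j) (fun j => -((j + 1 : ℝ) * a j)) t) t := by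
    intro t
    refine HasDerivAt.add ?_ (hasDerivAt_trigSum k a b t)
    simpa using ((hasDerivAt_id t).const_mul β).const_add α
  obtain ⟨C, hC, hdis, hCcard, hC0⟩ :=
    exists_finset_zeros_deriv hd (hA.trans Set.Ioo_subset_Icc_self) h0
  have hdis' : Disjoint B C := Finset.disjoint_of_subset_left hBA hdis
  obtain ⟨hβ, hab⟩ := trigSum_coeff_eq_zero (Z := B ∪ C)
    (by rw [Finset.coe_union]; exact Set.union_subset (fun x hx => hA (hBA hx)) hC)
    (by rw [Finset.card_union_of_disjoint hdis']; omega)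
    (fun t ht => (Finset.mem_union.1 ht).elim (h1 t) (hC0 t))
  have hab' : ∀ j < k, a j = 0 ∧ b j = 0 := by
    intro j hj
    have hj1 : (j + 1 : ℝ) ≠ 0 := by positivity
    obtain ⟨h2, h3⟩ := hab j hj
    exact ⟨by simpa [hj1] using h3, by simpa [hj1] using h2⟩
  have hne : A.Nonempty := by
    rw [← Finset.card_pos]
    have := Finset.card_le_card hBA
    omega
  obtain ⟨t, ht⟩ := hne
  have hs : trigSum k a b t = 0 := by
    refine Finset.sum_eq_zero fun j hj => ?_
    rw [(hab' j (Finset.mem_range.1 hj)).1, (hab' j (Finset.mem_range.1 hj)).2]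
    ring
  refine ⟨?_, hβ, hab'⟩
  simpa [hβ, hs] using h0 t ht

/-- A function that differs from `t ↦ t ^ 2` by an affine function and a trigonometric polynomial of
degree at most `k`, and has double zeros at `k + 1` points of `(0, 2π)`, is positive elsewhere in
`(0, 2π)`. -/
theorem sq_add_trigSum_pos {k : ℕ} {α β : ℝ} {a b : ℕ → ℝ} {A : Finset ℝ}
    (hA : ↑A ⊆ Set.Ioo 0 (2 * Real.pi)) (hcard : A.card = k + 1)
    (h0 : ∀ t ∈ A, t ^ 2 + α + β * t + trigSum k a b t = 0)
    (h1 : ∀ t ∈ A, 2 * t + β +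
      trigSum k (fun j => (j + 1 : ℝ) * b j) (fun j => -((j + 1 : ℝ) * a j)) t = 0) :
    ∀ t ∈ Set.Ioo 0 (2 * Real.pi), t ∉ A → 0 < t ^ 2 + α + β * t + trigSum k a b t := by
  set a' : ℕ → ℝ := fun j => (j + 1 : ℝ) * b j
  set b' : ℕ → ℝ := fun j => -((j + 1 : ℝ) * a j)
  set a'' : ℕ → ℝ := fun j => (j + 1 : ℝ) * b' j
  set b'' : ℕ → ℝ := fun j => -((j + 1 : ℝ) * a' j)
  set G : ℝ → ℝ := fun t => t ^ 2 + α + β * t + trigSum k a b t with hG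
  set G' : ℝ → ℝ := fun t => 2 * t + β + trigSum k a' b' t with hG'
  set G'' : ℝ → ℝ := fun t => 2 + trigSum k a'' b'' t with hG''
  have hd : ∀ t, HasDerivAt G (G' t) t := by
    intro t
    refine HasDerivAt.add ?_ (hasDerivAt_trigSum k a b t)
    refine HasDerivAt.add ?_ (by simpa using (hasDerivAt_id t).const_mul β)
    simpa using ((hasDerivAt_id t).pow 2).add_const α
  have hd' : ∀ t, HasDerivAt G' (G'' t) t := by
    intro t
    refine HasDerivAt.add ?_ (hasDerivAt_trigSum k a' b' t)
    simpa using ((hasDerivAt_id t).const_mul (2 : ℝ)).add_const β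
  have hGc : Continuous G := continuous_iff_continuousAt.2 fun t => (hd t).continuousAt
  have hGc' : Continuous G' := continuous_iff_continuousAt.2 fun t => (hd' t).continuousAt
  have hpi := Real.two_pi_pos
  -- zeros of `G'`, those of `W` counting twice
  have count : ∀ Z W : Finset ℝ, ↑Z ⊆ Set.Icc 0 (2 * Real.pi) → (∀ t ∈ Z, G' t = 0) →
      W ⊆ Z → ↑W ⊆ Set.Ioo 0 (2 * Real.pi) → (∀ t ∈ W, G'' t = 0) →
      Z.card + W.card ≤ 2 * k + 1 := by
    intro Z W hZ hZ0 hWZ hW hW0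
    by_contra! hlt
    obtain ⟨C, hC, hdis, hCcard, hC0⟩ := exists_finset_zeros_deriv hd' hZ hZ0
    have := (trigSum_coeff_eq_zero (k := k) (c := 2) (a := a'') (b := b'') (Z := W ∪ C)
      (by rw [Finset.coe_union]; exact Set.union_subset hW hC)
      (by rw [Finset.card_union_of_disjoint (Finset.disjoint_of_subset_left hWZ hdis)]; omega)
      (fun t ht => (Finset.mem_union.1 ht).elim (hW0 t) (hC0 t))).1
    norm_num at this
  have hAne : A.Nonempty := by rw [← Finset.card_pos]; omega
  set l := A.min' hAne
  set u := A.max' hAne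
  have hl : l ∈ A := A.min'_mem hAne
  have hu : u ∈ A := A.max'_mem hAne
  obtain ⟨C, hC, hdis, hCcard, hC0⟩ := exists_finset_zeros_deriv hd
    (A := A) (l := l) (u := u) (fun t ht => ⟨A.min'_le t ht, A.le_max' t ht⟩) h0
  have hZcard : 2 * k + 1 ≤ (A ∪ C).card := by
    rw [Finset.card_union_of_disjoint hdis]; omega
  have hZ0 : ∀ t ∈ A ∪ C, G' t = 0 := fun t ht => (Finset.mem_union.1 ht).elim (h1 t) (hC0 t)
  have hZlu : ∀ t ∈ A ∪ C, t ∈ Set.Icc l u := fun t ht => (Finset.mem_union.1 ht).elim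
    (fun ht => ⟨A.min'_le t ht, A.le_max' t ht⟩) (fun ht => Set.Ioo_subset_Icc_self (hC ht))
  have hZ : ↑(A ∪ C) ⊆ Set.Icc 0 (2 * Real.pi) := fun t ht =>
    ⟨(hA hl).1.le.trans (hZlu t ht).1, (hZlu t ht).2.trans (hA hu).2.le⟩
  have hout : ∀ t ∈ Set.Icc 0 (2 * Real.pi), t ∉ Set.Icc l u → G' t ≠ 0 := by
    intro t ht htlu hzero
    have := count (insert t (A ∪ C)) ∅ (by rw [Finset.coe_insert]; exact Set.insert_subset ht hZ)
      (by
        intro s hs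
        rcases Finset.mem_insert.1 hs with rfl | hs
        · exact hzero
        · exact hZ0 s hs) (by simp) (by simp) (by simp)
    rw [Finset.card_insert_of_notMem (fun h => htlu (hZlu t h))] at this
    omega
  have hG2 : ∀ t ∈ A, G'' t ≠ 0 := by
    intro t ht hzero
    have := count (A ∪ C) {t} hZ hZ0 (by simp [ht])
      (by simpa using hA ht) (by simpa using hzero)
    rw [Finset.card_singleton] at this
    omega
  have hne : ∀ t ∈ Set.Ioo 0 (2 * Real.pi), t ∉ A → G t ≠ 0 := by
    intro t ht htA hzero
    have hA' : ↑(insert t A) ⊆ Set.Ioo 0 (2 * Real.pi) := by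
      rw [Finset.coe_insert]; exact Set.insert_subset ht hA
    obtain ⟨D, hD, hdis, hDcard, hD0⟩ := exists_finset_zeros_deriv hd
      (hA'.trans Set.Ioo_subset_Icc_self) (by
        intro s hs
        rcases Finset.mem_insert.1 hs with rfl | hs
        · exact hzero
        · exact h0 s hs)
    rw [Finset.card_insert_of_notMem htA] at hDcard
    have := count (A ∪ D) ∅
      (by
        rw [Finset.coe_union]
        exact (Set.union_subset hA hD).trans Set.Ioo_subset_Icc_self)
      (fun t ht => (Finset.mem_union.1 ht).elim (h1 t) (hD0 t)) (by simp) (by simp) (by simp)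
    rw [Finset.card_union_of_disjoint
      (Finset.disjoint_of_subset_left (Finset.subset_insert t A) hdis)] at this
    simp only [Finset.card_empty] at this
    omega
  -- `G` has constant sign
  have hopen : ∀ p : ℝ → Prop, IsOpen {t : ℝ | ∀ᶠ s in nhds t, s ≠ t → p s} := by
    intro p
    rw [isOpen_iff_mem_nhds]
    intro t ht
    filter_upwards [eventually_eventually_nhds.2 ht] with y hy
    rcases eq_or_ne y t with rfl | hyt
    · exact ht
    · filter_upwards [hy, isOpen_ne.mem_nhds hyt] with s hs hst _ using hs hst
  have hcover : Set.Ioo 0 (2 * Real.pi) ⊆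
      {t : ℝ | ∀ᶠ s in nhds t, s ≠ t → 0 < G s} ∪ {t : ℝ | ∀ᶠ s in nhds t, s ≠ t → G s < 0} := by
    intro t ht
    by_cases htA : t ∈ A
    · have hev : ∀ᶠ s in nhds t, s ≠ t → G s ≠ 0 := by
        have h2 : ∀ᶠ s in nhds t, s ∉ A.erase t :=
          (A.erase t).finite_toSet.isClosed.isOpen_compl.mem_nhds (by simp)
        filter_upwards [isOpen_Ioo.mem_nhds ht, h2] with s hs hs2 hst
        exact hne s hs fun hsA => hs2 (Finset.mem_erase.2 ⟨hst, hsA⟩)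
      have e1 : deriv G = G' := funext fun s => (hd s).deriv
      have e2 : deriv G' = G'' := funext fun s => (hd' s).deriv
      have hGt : G t = 0 := h0 t htA
      rcases (hG2 t htA).lt_or_gt with hlt | hgt
      · right
        have hmax := isLocalMax_of_deriv_deriv_neg (f := G) (x₀ := t) (by rw [e1, e2]; exact hlt)
          (by rw [e1]; exact h1 t htA) hGc.continuousAt
        filter_upwards [hmax, hev] with s hs hs2 hst
        exact lt_of_le_of_ne (hs.trans_eq hGt) (hs2 hst)
      · left
        have hmin := isLocalMin_of_deriv_deriv_pos (f := G) (x₀ := t) (by rw [e1, e2]; exact hgt)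
          (by rw [e1]; exact h1 t htA) hGc.continuousAt
        filter_upwards [hmin, hev] with s hs hs2 hst
        exact lt_of_le_of_ne (hGt.symm.trans_le hs) (hs2 hst).symm
    · rcases (hne t ht htA).lt_or_gt with hlt | hgt
      · right
        filter_upwards [hGc.continuousAt.eventually_lt_const hlt] with s hs _ using hs
      · left
        filter_upwards [hGc.continuousAt.eventually_const_lt hgt] with s hs _ using hs
  have hclash : ∀ t : ℝ, (∀ᶠ s in nhds t, s ≠ t → 0 < G s) → (∀ᶠ s in nhds t, s ≠ t → G s < 0) →
      False := by
    intro t hp hn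
    have hp' : ∀ᶠ s in nhdsWithin t {t}ᶜ, 0 < G s := eventually_nhdsWithin_iff.2 hp
    have hn' : ∀ᶠ s in nhdsWithin t {t}ᶜ, G s < 0 := eventually_nhdsWithin_iff.2 hn
    obtain ⟨s, hs1, hs2⟩ := (hp'.and hn').exists
    exact lt_asymm hs1 hs2
  rcases isPreconnected_Ioo.subset_or_subset (hopen fun s => 0 < G s) (hopen fun s => G s < 0)
    (Set.disjoint_left.2 hclash) hcover with hpos | hneg
  · intro t ht htA
    rcases (hne t ht htA).lt_or_gt with hlt | hgt
    · refine (hclash t (hpos ht) ?_).elim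
      filter_upwards [hGc.continuousAt.eventually_lt_const hlt] with s hs _ using hs
    · exact hgt
  · exfalso
    have hneg' : ∀ t ∈ Set.Ioo 0 (2 * Real.pi), t ∉ A → G t < 0 := by
      intro t ht htA
      rcases (hne t ht htA).lt_or_gt with hlt | hgt
      · exact hlt
      · refine (hclash t ?_ (hneg ht)).elim
        filter_upwards [hGc.continuousAt.eventually_const_lt hgt] with s hs _ using hs
    have hl0 := (hA hl).1
    have hl2 := (hA hl).2
    have hu0 := (hA hu).1
    have hu2 := (hA hu).2
    have hGl : G l = 0 := h0 l hl
    have hGu : G u = 0 := h0 u hu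
    have hleft : 0 < G' 0 := by
      by_contra! hle
      have hs : G (l / 2) < 0 := hneg' _ ⟨by linarith, by linarith⟩ fun h => by
        have := A.min'_le _ h
        change l ≤ l / 2 at this
        linarith
      obtain ⟨ξ, hξ, hξ'⟩ := exists_hasDerivAt_eq_slope G G' (show l / 2 < l by linarith)
        hGc.continuousOn (fun t _ => hd t)
      have hpos : 0 < G' ξ := by
        rw [hξ']
        exact div_pos (by linarith) (by linarith)
      have hξ0 : (0 : ℝ) ≤ ξ := by linarith [hξ.1]
      obtain ⟨s, hs, hs0⟩ := intermediate_value_Icc hξ0 hGc'.continuousOn ⟨hle, hpos.le⟩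
      exact hout s ⟨hs.1, by linarith [hs.2, hξ.2]⟩ (fun h => by linarith [h.1, hs.2, hξ.2]) hs0
    have hright : G' (2 * Real.pi) < 0 := by
      by_contra! hle
      have hs : G ((u + 2 * Real.pi) / 2) < 0 := hneg' _ ⟨by linarith, by linarith⟩ fun h => by
        have := A.le_max' _ h
        change _ ≤ u at this
        linarith
      obtain ⟨ξ, hξ, hξ'⟩ := exists_hasDerivAt_eq_slope G G'
        (show u < (u + 2 * Real.pi) / 2 by linarith) hGc.continuousOn (fun t _ => hd t)
      have hlt : G' ξ < 0 := by
        rw [hξ']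
        exact div_neg_of_neg_of_pos (by linarith) (by linarith)
      have hξ0 : ξ ≤ 2 * Real.pi := by linarith [hξ.2]
      obtain ⟨s, hs, hs0⟩ := intermediate_value_Icc hξ0 hGc'.continuousOn ⟨hlt.le, hle⟩
      exact hout s ⟨by linarith [hs.1, hξ.1], hs.2⟩ (fun h => by linarith [h.2, hs.1, hξ.1]) hs0
    have hper := trigSum_add_two_pi k a' b' 0
    rw [zero_add] at hper
    simp only [hG'] at hleft hright
    rw [hper] at hright
    linarith

/-- The `n`-th coordinate of `x`, and `0` if there is none. -/
noncomputable def coordOrZero {d : ℕ} (x : EuclideanSpace ℝ (Fin d)) (n : ℕ) : ℝ :=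
  if h : n < d then x ⟨n, h⟩ else 0

theorem coordOrZero_add {d : ℕ} (x y : EuclideanSpace ℝ (Fin d)) (n : ℕ) :
    coordOrZero (x + y) n = coordOrZero x n + coordOrZero y n := by
  unfold coordOrZero; split <;> simp

theorem coordOrZero_smul {d : ℕ} (c : ℝ) (x : EuclideanSpace ℝ (Fin d)) (n : ℕ) :
    coordOrZero (c • x) n = c * coordOrZero x n := by
  unfold coordOrZero; split <;> simp

theorem sum_range_two_mul_add_one (u : ℕ → ℝ) (k : ℕ) :
    ∑ n ∈ Finset.range (2 * k + 1), u n =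
      u 0 + ∑ j ∈ Finset.range k, (u (2 * j + 1) + u (2 * j + 2)) := by
  induction k with
  | zero => simp
  | succ k ih =>
    rw [show 2 * (k + 1) + 1 = 2 * k + 1 + 1 + 1 by ring, Finset.sum_range_succ,
      Finset.sum_range_succ, ih, Finset.sum_range_succ]
    ring

theorem sum_coordOrZero_mul {d : ℕ} (x y : EuclideanSpace ℝ (Fin d)) :
    inner ℝ x y = ∑ n ∈ Finset.range d, coordOrZero x n * coordOrZero y n := by
  rw [← Fin.sum_univ_eq_sum_range (fun n => coordOrZero x n * coordOrZero y n), PiLp.inner_apply]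
  refine Finset.sum_congr rfl fun i _ => ?_
  simp [coordOrZero, mul_comm]

theorem coordOrZero_genHelix_zero (k : ℕ) (t : ℝ) : coordOrZero (genHelix k t) 0 = t := by
  simp [coordOrZero, genHelix]

theorem coordOrZero_genHelix_odd {k j : ℕ} (hj : j < k) (t : ℝ) :
    coordOrZero (genHelix k t) (2 * j + 1) = Real.cos ((j + 1 : ℝ) * t) := by
  have h1 : 2 * j + 1 < 2 * k + 1 := by omega
  have h2 : (2 * j + 1) % 2 = 1 := by omega
  have h3 : (2 * j + 1 + 1) / 2 = j + 1 := by omega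
  rw [coordOrZero, dif_pos h1, genHelix]
  simp only [if_neg (Nat.succ_ne_zero (2 * j)), h2, if_true, h3]
  push_cast; rfl

theorem coordOrZero_genHelix_even {k j : ℕ} (hj : j < k) (t : ℝ) :
    coordOrZero (genHelix k t) (2 * j + 2) = Real.sin ((j + 1 : ℝ) * t) := by
  have h1 : 2 * j + 2 < 2 * k + 1 := by omega
  have h2 : ¬ (2 * j + 2) % 2 = 1 := by omega
  have h3 : (2 * j + 2) / 2 = j + 1 := by omega
  rw [coordOrZero, dif_pos h1, genHelix]
  simp only [if_neg (Nat.succ_ne_zero (2 * j + 1)), if_neg h2, h3]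
  push_cast; rfl

/-- The derivative of `t ↦ ⟪x, genHelix k t⟫`. -/
noncomputable def innerGenHelixDeriv (k : ℕ) (x : EuclideanSpace ℝ (Fin (2 * k + 1))) (t : ℝ) : ℝ :=
  coordOrZero x 0 + trigSum k (fun j => (j + 1 : ℝ) * coordOrZero x (2 * j + 2))
    (fun j => -((j + 1 : ℝ) * coordOrZero x (2 * j + 1))) t

theorem inner_genHelix (k : ℕ) (x : EuclideanSpace ℝ (Fin (2 * k + 1))) (t : ℝ) :
    inner ℝ x (genHelix k t) = coordOrZero x 0 * t +
      trigSum k (fun j => coordOrZero x (2 * j + 1)) (fun j => coordOrZero x (2 * j + 2)) t := by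
  rw [sum_coordOrZero_mul, sum_range_two_mul_add_one, coordOrZero_genHelix_zero, trigSum]
  congr 1
  refine Finset.sum_congr rfl fun j hj => ?_
  rw [coordOrZero_genHelix_odd (Finset.mem_range.1 hj),
    coordOrZero_genHelix_even (Finset.mem_range.1 hj)]

theorem inner_genHelix_self (k : ℕ) (t : ℝ) :
    inner ℝ (genHelix k t) (genHelix k t) = t ^ 2 + k := by
  rw [sum_coordOrZero_mul, sum_range_two_mul_add_one, coordOrZero_genHelix_zero,
    Finset.sum_congr rfl (g := fun _ => (1 : ℝ))]
  · simp [sq]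
  · intro j hj
    rw [coordOrZero_genHelix_odd (Finset.mem_range.1 hj),
      coordOrZero_genHelix_even (Finset.mem_range.1 hj), ← sq, ← sq, Real.cos_sq_add_sin_sq]

theorem dist_genHelix_sq (k : ℕ) (x : EuclideanSpace ℝ (Fin (2 * k + 1))) (t : ℝ) :
    dist x (genHelix k t) ^ 2 = ‖x‖ ^ 2 - 2 * inner ℝ x (genHelix k t) + (t ^ 2 + k) := by
  rw [dist_eq_norm, norm_sub_sq_real, ← inner_genHelix_self, real_inner_self_eq_norm_sq]

/-- Hermite interpolation by functions `t ↦ α + ⟪x, genHelix k t⟫`: values are prescribed on `A`,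
derivatives on `B`. -/
theorem exists_hermite_interpolation {k : ℕ} {A B : Finset ℝ}
    (hA : ↑A ⊆ Set.Ioo 0 (2 * Real.pi)) (hBA : B ⊆ A) (hcard : A.card + B.card = 2 * k + 2)
    (u v : ℝ → ℝ) :
    ∃ (α : ℝ) (x : EuclideanSpace ℝ (Fin (2 * k + 1))),
      (∀ t ∈ A, α + inner ℝ x (genHelix k t) = u t) ∧ ∀ t ∈ B, innerGenHelixDeriv k x t = v t := by
  let Φ : (ℝ × EuclideanSpace ℝ (Fin (2 * k + 1))) →ₗ[ℝ] (A → ℝ) × (B → ℝ) :=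
    { toFun := fun p => (fun t => p.1 + inner ℝ p.2 (genHelix k t),
        fun t => innerGenHelixDeriv k p.2 t)
      map_add' := by
        intro p q
        refine Prod.ext (funext fun t => ?_) (funext fun t => ?_)
        · simp only [Prod.fst_add, Prod.snd_add, inner_add_left, Pi.add_apply]
          ring
        · simp only [innerGenHelixDeriv, trigSum, Prod.snd_add, coordOrZero_add, Pi.add_apply]
          rw [add_add_add_comm, ← Finset.sum_add_distrib]
          congr 1
          refine Finset.sum_congr rfl fun j _ => ?_
          ring
      map_smul' := by
        intro c p
        refine Prod.ext (funext fun t => ?_) (funext fun t => ?_)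
        · simp only [Prod.smul_fst, Prod.smul_snd, real_inner_smul_left, Pi.smul_apply,
            smul_eq_mul, RingHom.id_apply]
          ring
        · simp only [innerGenHelixDeriv, trigSum, Prod.smul_snd, coordOrZero_smul, Pi.smul_apply,
            smul_eq_mul, RingHom.id_apply]
          rw [mul_add, Finset.mul_sum]
          congr 1
          refine Finset.sum_congr rfl fun j _ => ?_
          ring }
  have hinj : Function.Injective Φ := by
    rw [← LinearMap.ker_eq_bot, LinearMap.ker_eq_bot']
    rintro ⟨α, x⟩ h
    have h0 : ∀ t ∈ A, α + inner ℝ x (genHelix k t) = 0 := fun t ht =>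
      congrFun (congrArg Prod.fst h) ⟨t, ht⟩
    have h1 : ∀ t ∈ B, innerGenHelixDeriv k x t = 0 := fun t ht =>
      congrFun (congrArg Prod.snd h) ⟨t, ht⟩
    obtain ⟨hα, hβ, hab⟩ := affine_add_trigSum_coeff_eq_zero (k := k) (α := α)
      (a := fun j => coordOrZero x (2 * j + 1)) (b := fun j => coordOrZero x (2 * j + 2))
      hA hBA hcard.ge (fun t ht => by rw [add_assoc, ← inner_genHelix]; exact h0 t ht) h1
    have hx : x = 0 := by
      rw [← inner_self_eq_zero (𝕜 := ℝ), sum_coordOrZero_mul, sum_range_two_mul_add_one, hβ,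
        Finset.sum_eq_zero]
      · simp
      · intro j hj
        rw [(hab j (Finset.mem_range.1 hj)).1, (hab j (Finset.mem_range.1 hj)).2]
        simp
    rw [hα, hx]; rfl
  have hsurj : Function.Surjective Φ := by
    refine (LinearMap.injective_iff_surjective_of_finrank_eq_finrank ?_).1 hinj
    simp only [Module.finrank_prod, Module.finrank_self, finrank_euclideanSpace_fin,
      Module.finrank_fintype_fun_eq_card, Fintype.card_coe]
    omega
  obtain ⟨⟨α, x⟩, h⟩ := hsurj (fun t => u t, fun t => v t)
  exact ⟨α, x, fun t ht => congrFun (congrArg Prod.fst h) ⟨t, ht⟩,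
    fun t ht => congrFun (congrArg Prod.snd h) ⟨t, ht⟩⟩

theorem mem_iInter_voronoiDiagram {d : ℕ} {P : Set (EuclideanSpace ℝ (Fin d))} {s : Finset P}
    {y : EuclideanSpace ℝ (Fin d)} :
    y ∈ ⋂ i ∈ s, voronoiDiagram P i ↔ ∀ p ∈ s, ∀ q : P, dist y p ≤ dist y q := by
  simp [voronoiDiagram, voronoiRegion]

theorem dist_le_dist_iff_inner_le {d : ℕ} (x p q : EuclideanSpace ℝ (Fin d)) :
    dist x p ≤ dist x q ↔ inner ℝ (q - p) x ≤ (‖q‖ ^ 2 - ‖p‖ ^ 2) / 2 := by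
  rw [← sq_le_sq₀ dist_nonneg dist_nonneg, dist_eq_norm, dist_eq_norm, norm_sub_sq_real,
    norm_sub_sq_real, inner_sub_left, real_inner_comm x p, real_inner_comm x q]
  constructor <;> intro h <;> linarith

theorem isConvexPolyhedron_voronoiRegion {d : ℕ} {P : Set (EuclideanSpace ℝ (Fin d))}
    (hfin : P.Finite) (p : EuclideanSpace ℝ (Fin d)) :
    IsConvexPolyhedron (voronoiRegion P p) := by
  classical
  refine ⟨hfin.toFinset.image fun q => (q - p, (‖q‖ ^ 2 - ‖p‖ ^ 2) / 2), ?_⟩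
  ext x
  simp [voronoiRegion, dist_le_dist_iff_inner_le]

theorem vectorSpan_iInter_voronoiDiagram_le {d : ℕ} {P : Set (EuclideanSpace ℝ (Fin d))}
    (s : Finset P) :
    vectorSpan ℝ (⋂ i ∈ s, voronoiDiagram P i) ≤
      (vectorSpan ℝ (Set.range fun i : s => (i : EuclideanSpace ℝ (Fin d))))ᗮ := by
  have key : ∀ y ∈ ⋂ i ∈ s, voronoiDiagram P i, ∀ p q : s,
      inner ℝ ((p : EuclideanSpace ℝ (Fin d)) - q) y =
        (‖(p : EuclideanSpace ℝ (Fin d))‖ ^ 2 - ‖(q : EuclideanSpace ℝ (Fin d))‖ ^ 2) / 2 := by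
    intro y hy p q
    rw [mem_iInter_voronoiDiagram] at hy
    have h1 := (dist_le_dist_iff_inner_le _ _ _).1 (hy p p.2 q)
    have h2 := (dist_le_dist_iff_inner_le _ _ _).1 (hy q q.2 p)
    rw [inner_sub_left] at h1 h2 ⊢
    linarith
  rw [vectorSpan_def, Submodule.span_le]
  rintro _ ⟨y, hy, z, hz, rfl⟩
  rw [SetLike.mem_coe, Submodule.mem_orthogonal, vectorSpan_def]
  intro w hw
  induction hw using Submodule.span_induction with
  | mem w hw =>
    obtain ⟨_, ⟨p, rfl⟩, _, ⟨q, rfl⟩, rfl⟩ := hw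
    change inner ℝ (((p : P) : EuclideanSpace ℝ (Fin d)) - (q : P)) (y - z) = 0
    rw [inner_sub_right, key y hy p q, key z hz p q, sub_self]
  | zero => simp
  | add a b _ _ ha hb => rw [inner_add_left, ha, hb, add_zero]
  | smul c a _ ha => rw [real_inner_smul_left, ha, mul_zero]

theorem finrank_orthogonal_vectorSpan {d : ℕ} {P : Set (EuclideanSpace ℝ (Fin d))} {s : Finset P}
    (hs : s.Nonempty)
    (hind : AffineIndependent ℝ fun i : s => (i : EuclideanSpace ℝ (Fin d))) :
    (Module.finrank ℝ (vectorSpan ℝ (Set.range fun i : s => (i : EuclideanSpace ℝ (Fin d))))ᗮ : ℤ) =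
      d - s.card + 1 := by
  have h1 := (vectorSpan ℝ
    (Set.range fun i : s => (i : EuclideanSpace ℝ (Fin d)))).finrank_add_finrank_orthogonal
  have h3 := hs.card_pos
  have h2 := hind.finrank_vectorSpan (n := s.card - 1) (by rw [Fintype.card_coe]; omega)
  rw [finrank_euclideanSpace_fin, h2] at h1
  omega

/-- If some point is equally far from the affinely independent sites in `s` and farther from all
other sites, then the regions of `s` meet in the expected dimension. -/
theorem hasAffineDim_iInter_voronoiDiagram {d : ℕ} {P : Set (EuclideanSpace ℝ (Fin d))}
    (hfin : P.Finite) {s : Finset P} (hs : s.Nonempty)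
    (hind : AffineIndependent ℝ fun i : s => (i : EuclideanSpace ℝ (Fin d)))
    {x : EuclideanSpace ℝ (Fin d)} (heq : ∀ p ∈ s, ∀ q ∈ s, dist x p = dist x q)
    (hlt : ∀ p ∈ s, ∀ q : P, q ∉ s → dist x p < dist x q) :
    HasAffineDim (⋂ i ∈ s, voronoiDiagram P i) (d - s.card + 1) := by
  have hx : x ∈ ⋂ i ∈ s, voronoiDiagram P i := by
    rw [mem_iInter_voronoiDiagram]
    intro p hp q
    by_cases hq : q ∈ s
    · exact (heq p hp q hq).le
    · exact (hlt p hp q hq).le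
  refine ⟨⟨x, hx⟩, ?_⟩
  rw [← finrank_orthogonal_vectorSpan hs hind, (vectorSpan_iInter_voronoiDiagram_le s).antisymm]
  intro v hv
  have : Finite P := hfin
  have hev : ∀ᶠ ε : ℝ in nhds 0, ∀ p ∈ s, ∀ q : P, q ∉ s → dist (x + ε • v) p < dist (x + ε • v) q := by
    rw [Filter.eventually_all_finset]
    intro p hp
    rw [Filter.eventually_all]
    intro q
    by_cases hq : q ∈ s
    · simp [hq]
    have hc : ∀ r : P, ContinuousAt (fun ε : ℝ => dist (x + ε • v) r) 0 := fun r => by fun_prop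
    filter_upwards [(hc p).eventually_lt (hc q) (by simpa using hlt p hp q hq)] with ε h _ using h
  obtain ⟨ε, hε, hε0⟩ := ((hev.filter_mono nhdsWithin_le_nhds).and
    (self_mem_nhdsWithin (a := (0 : ℝ)) (s := {0}ᶜ))).exists
  have hmem : x + ε • v ∈ ⋂ i ∈ s, voronoiDiagram P i := by
    rw [mem_iInter_voronoiDiagram]
    intro p hp q
    by_cases hq : q ∈ s
    · rw [dist_le_dist_iff_inner_le, inner_add_right, real_inner_smul_right]
      have h0 : inner ℝ ((q : EuclideanSpace ℝ (Fin d)) - p) v = 0 :=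
        (Submodule.mem_orthogonal _ _).1 hv _
          (vsub_mem_vectorSpan ℝ ⟨⟨q, hq⟩, rfl⟩ ⟨⟨p, hp⟩, rfl⟩)
      rw [h0, mul_zero, add_zero]
      exact (dist_le_dist_iff_inner_le _ _ _).1 (heq p hp q hq).le
    · exact (hε p hp q hq).le
  have h := vsub_mem_vectorSpan ℝ hmem hx
  rw [vsub_eq_sub, add_sub_cancel_left] at h
  exact ((vectorSpan ℝ _).smul_mem_iff hε0).1 h

theorem affineIndependent_genHelix {k : ℕ} {A B : Finset ℝ}
    (hA : ↑A ⊆ Set.Ioo 0 (2 * Real.pi)) (hBA : B ⊆ A) (hcard : A.card + B.card = 2 * k + 2) :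
    AffineIndependent ℝ fun t : A => genHelix k t := by
  classical
  rw [affineIndependent_iff]
  intro S w hw hwp i hi
  obtain ⟨α, x, hx, -⟩ :=
    exists_hermite_interpolation hA hBA hcard (fun t => if t = i then 1 else 0) 0
  have h1 : ∑ e ∈ S, w e * (α + inner ℝ x (genHelix k e)) = 0 := by
    have h2 := congrArg (fun y => inner ℝ x y) hwp
    simp only [inner_sum, real_inner_smul_right, inner_zero_right] at h2
    simp only [mul_add, Finset.sum_add_distrib, ← Finset.sum_mul]
    rw [hw, h2, zero_mul, add_zero]
  rw [Finset.sum_eq_single i] at h1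
  · simpa [hx i i.2] using h1
  · intro e _ hei
    rw [hx e e.2, if_neg (fun h => hei (Subtype.ext h)), mul_zero]
  · exact fun h => absurd hi h

/-- At most `2k + 2` points of the helix, and at least `k + 1`, are affinely independent. -/
theorem affineIndependent_of_subset_genHelix {k : ℕ} {P : Set (EuclideanSpace ℝ (Fin (2 * k + 1)))}
    (hP : P ⊆ genHelix k '' Set.Ioo 0 (2 * Real.pi)) {s : Finset P} (h1 : k + 1 ≤ s.card)
    (h2 : s.card ≤ 2 * k + 2) :
    AffineIndependent ℝ fun i : s => (i : EuclideanSpace ℝ (Fin (2 * k + 1))) := by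
  classical
  choose τ hτ hτP using fun p : P => hP p.2
  have hinj : Function.Injective τ := fun p q h => Subtype.ext (by rw [← hτP p, h, hτP q])
  have hcard : (s.image τ).card = s.card := Finset.card_image_of_injective _ hinj
  obtain ⟨B, hB, hBcard⟩ := Finset.exists_subset_card_eq
    (show 2 * k + 2 - s.card ≤ (s.image τ).card by omega)
  have hA : ↑(s.image τ) ⊆ Set.Ioo 0 (2 * Real.pi) := by
    intro t ht
    obtain ⟨p, _, rfl⟩ := Finset.mem_image.1 ht
    exact hτ p
  have h := (affineIndependent_genHelix (k := k) hA hB (by omega)).comp_embedding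
    ⟨fun i : s => (⟨τ i, Finset.mem_image_of_mem τ i.2⟩ : s.image τ),
      fun i j hij => Subtype.ext (hinj (congrArg Subtype.val hij))⟩
  have e : (fun i : s => (i : EuclideanSpace ℝ (Fin (2 * k + 1)))) = fun i : s =>
      genHelix k (τ i) := funext fun i => (hτP i).symm
  rw [e]
  exact h

/-- Any `k + 1` points of the helix lie on a sphere that touches the helix at them, all its other
points lying strictly outside. -/
theorem exists_center_genHelix {k : ℕ} {A : Finset ℝ} (hA : ↑A ⊆ Set.Ioo 0 (2 * Real.pi))
    (hcard : A.card = k + 1) :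
    ∃ (x : EuclideanSpace ℝ (Fin (2 * k + 1))) (r : ℝ), (∀ t ∈ A, dist x (genHelix k t) ^ 2 = r) ∧
      ∀ t ∈ Set.Ioo 0 (2 * Real.pi), t ∉ A → r < dist x (genHelix k t) ^ 2 := by
  obtain ⟨α, x, hx, hx'⟩ := exists_hermite_interpolation (k := k) hA subset_rfl (by omega)
    (fun t => -(t ^ 2 + k)) (fun t => -(2 * t))
  have hdist : ∀ t, dist ((-1 / 2 : ℝ) • x) (genHelix k t) ^ 2 =
      ‖(-1 / 2 : ℝ) • x‖ ^ 2 - α + (t ^ 2 + (k + α) + inner ℝ x (genHelix k t)) := by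
    intro t
    rw [dist_genHelix_sq, real_inner_smul_left]
    ring
  refine ⟨(-1 / 2 : ℝ) • x, ‖(-1 / 2 : ℝ) • x‖ ^ 2 - α, fun t ht => ?_, fun t ht htA => ?_⟩
  · rw [hdist]
    linarith [hx t ht]
  · have := sq_add_trigSum_pos (k := k) (α := k + α) (β := coordOrZero x 0)
      (a := fun j => coordOrZero x (2 * j + 1)) (b := fun j => coordOrZero x (2 * j + 2)) hA hcard
      (fun t ht => by rw [add_assoc, ← inner_genHelix]; linarith [hx t ht])
      (fun t ht => by
        have := hx' t ht
        rw [innerGenHelixDeriv] at this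
        linarith) t ht htA
    rw [add_assoc, ← inner_genHelix] at this
    rw [hdist]
    linarith

theorem mainTheorem4 (k : ℕ) (P : Set (EuclideanSpace ℝ (Fin (2 * k + 1))))
    (hfin : P.Finite) (hP : P ⊆ genHelix k '' Set.Ioo 0 (2 * Real.pi)) :
    IsNeighborlyFamily (k + 1) (voronoiDiagram P) := by
  classical
  refine ⟨fun p => isConvexPolyhedron_voronoiRegion hfin p, fun p => ?_, fun s hs => ?_,
    fun s hs hdim => ?_⟩
  · have h := hasAffineDim_iInter_voronoiDiagram hfin (s := {p}) (x := p)
      (Finset.singleton_nonempty p)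
      (affineIndependent_of_subsingleton ℝ _)
      (by simp) (by
        intro q hq r hr
        rw [Finset.mem_singleton] at hq hr
        rw [hq, dist_self]
        exact dist_pos.2 fun h => hr (Subtype.ext h.symm))
    simpa using h
  · choose τ hτ hτP using fun p : P => hP p.2
    have hinj : Function.Injective τ := fun p q h => Subtype.ext (by rw [← hτP p, h, hτP q])
    obtain ⟨x, r, hx, hx'⟩ := exists_center_genHelix (k := k) (A := s.image τ)
      (by
        intro t ht
        obtain ⟨p, _, rfl⟩ := Finset.mem_image.1 ht
        exact hτ p)
      (by rw [Finset.card_image_of_injective _ hinj, hs])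
    have hx1 : ∀ p ∈ s, dist x (p : EuclideanSpace ℝ (Fin (2 * k + 1))) ^ 2 = r := fun p hp => by
      rw [← hτP p]
      exact hx _ (Finset.mem_image_of_mem τ hp)
    have hx2 : ∀ p ∉ s, r < dist x (p : EuclideanSpace ℝ (Fin (2 * k + 1))) ^ 2 := fun p hp => by
      rw [← hτP p]
      exact hx' _ (hτ p) fun h => hp (hinj.mem_finset_image.1 h)
    have h := hasAffineDim_iInter_voronoiDiagram hfin (s := s) (x := x)
      (Finset.card_pos.1 (by omega))
      (affineIndependent_of_subset_genHelix hP (by omega) (by omega))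
      (fun p hp q hq => by
        rw [← sq_eq_sq₀ dist_nonneg dist_nonneg, hx1 p hp, hx1 q hq])
      (fun p hp q hq => by
        rw [← sq_lt_sq₀ dist_nonneg dist_nonneg, hx1 p hp]
        exact hx2 q hq)
    rwa [hs] at h
  · have h1 := Submodule.finrank_mono (vectorSpan_iInter_voronoiDiagram_le s)
    have h2 := finrank_orthogonal_vectorSpan (Finset.card_pos.1 (by omega))
      (affineIndependent_of_subset_genHelix hP (s := s) (by omega) (by omega))
    have h3 := hdim.2
    rw [hs] at h2
    push_cast at h2 h3
    omega
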